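/- For positive integers $d_i$ write $[d_1,d_2,\dots]=\cfrac1{d_1+\cfrac1{d_2+\cdots}}$ for a finite or infinite continued fraction, where an infinite one is the limit of its truncations and an overline denotes periodic repetition. Let $G(x)=\frac1x-\lfloor\frac1x\rfloor$. For $\alpha\in(0,1)$ put $D_\alpha=\bigcup_{n\ge1}\big[\frac1{n+\alpha},\frac1n\big]$ and let the flipped $\alpha$-continued fraction map $T_\alpha$ be the self-map of $[\min\{\alpha,1-\alpha\},1]$ given by $T_\alpha(x)=1-G(x)$ if $x\in D_\alpha$ and $T_\alpha(x)=G(x)$ otherwise. Every $a\in\mathbb Q\cap(0,1)$ has exactly two expansions $a=[a_1,\dots,a_n]=[a_1,\dots,a_n-1,1]$, with $a_n\ge2$. Its quadratic interval $I_a$ is the open interval with endpoints $[\overline{a_1,\dots,a_n}]$ and $[\overline{a_1,\dots,a_n-1,1}]$. For $a=1$ put $n=1$, $a_1=1$ and $I_1=(g,1)$ with $g=\frac{\sqrt5-1}2$. Let $\mathcal R$ be the set of all $a\in\mathbb Q\cap(0,1]$ such that $I_a$ is maximal, i.e. not properly contained in $I_b$ for any $b\in\mathbb Q\cap(0,1]$.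 For $a\in\mathcal R$ with digits $a_1,\dots,a_n$ as above, if $n$ is odd let $$J_a^L=\big([1,\overline{a_1,\dots,a_n-1,1}],\,[1,a_1,\dots,a_n-1,1]\big),\qquad J_a^R=\big([1,a_1,\dots,a_n],\,[1,\overline{a_1,\dots,a_n}]\big),$$ $$M=a_1+a_3+\cdots+a_n,\qquad N=a_2+a_4+\cdots+a_{n-1}+2,$$ except that $J_1^L=\emptyset$; if $n$ is even let $$J_a^L=\big([1,\overline{a_1,\dots,a_n}],\,[1,a_1,\dots,a_n]\big),\qquad J_a^R=\big([1,a_1,\dots,a_n-1,1],\,[1,\overline{a_1,\dots,a_n-1,1}]\big),$$ $$M=a_1+a_3+\cdots+a_{n-1}+1,\qquad N=a_2+a_4+\cdots+a_n+1.$$ **Theorem.** Let $a\in\mathcal R$. Then $T_\alpha^M(\alpha)=T_\alpha^N(1-\alpha)$ for every $\alpha\in J_a^L$, and $T_\alpha^{M+1}(\alpha)=T_\alpha^{N-1}(1-\alpha)$ for every $\alpha\in J_a^R$. Moreover, with $\frac1{1+I_a}=\{\frac1{1+x}:x\in I_a\}$, we have $\frac1{1+I_a}=J_a^L\cup J_a^R\cup\big\{\frac1{1+a}\big\}$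 if $a\ne1$, and $\frac1{1+I_1}=J_1^R$. -/

import Mathlib

namespace FlippedCF

open Filter Topology

/-- The Gauss map `G x = 1 / x - ⌊1 / x⌋`. -/
noncomputable def gauss (x : ℝ) : ℝ := 1 / x - (⌊1 / x⌋ : ℝ)

/-- The flip region `D_α = ⋃_{n ≥ 1} [1 / (n + α), 1 / n]`. -/
def flipRegion (α : ℝ) : Set ℝ :=
  ⋃ n : ℕ, ⋃ _ : 1 ≤ n, Set.Icc (1 / ((n : ℝ) + α)) (1 / (n : ℝ))

open Classical in
/-- The flipped `α`-continued fraction map: `1 - G` on `D_α` and `G` off `D_α`.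
It is only used on its domain `[min α (1 - α), 1]`, which it maps to itself, see `mapsTo_T`. -/
noncomputable def T (α x : ℝ) : ℝ :=
  if x ∈ flipRegion α then 1 - gauss x else gauss x

/-- The value `[a₁, …, aₙ]` of a finite continued fraction `1 / (a₁ + 1 / (a₂ + ⋯ + 1 / aₙ))`. -/
noncomputable def cfEval (w : List ℕ) : ℝ :=
  w.foldr (fun (d : ℕ) (x : ℝ) => 1 / ((d : ℝ) + x)) 0

/-- The value `[d 0, d 1, d 2, …]` of an infinite continued fraction, the limit of the finite ones.
The limit exists when all digits are positive, see `tendsto_cfLimit`. -/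
noncomputable def cfLimit (d : ℕ → ℕ) : ℝ :=
  limUnder atTop (fun n : ℕ => cfEval ((List.range n).map d))

/-- The digit sequence `u w w w ⋯` (for `w` not empty). -/
def evPeriodic (u w : List ℕ) (i : ℕ) : ℕ :=
  if i < u.length then u.getD i 0 else w.getD ((i - u.length) % w.length) 0

/-- The value of the eventually periodic continued fraction with digits `u w w w ⋯`. -/
noncomputable def cfPeriodic (u w : List ℕ) : ℝ := cfLimit (evPeriodic u w)

/-- The regular continued fraction digits of `p / q`, by the Euclidean algorithm. -/
def euclidDigits : ℕ → ℕ → List ℕ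
  | 0, _ => []
  | p + 1, q => q / (p + 1) :: euclidDigits (q % (p + 1)) (p + 1)
termination_by p => p
decreasing_by exact Nat.mod_lt _ (Nat.succ_pos _)

/-- The digits `a₁, …, aₙ` of a rational `0 < a ≤ 1`: the expansion with `aₙ ≥ 2` if `a < 1`,
and the one digit `1` if `a = 1`. -/
def digits (a : ℚ) : List ℕ := euclidDigits a.num.toNat a.den

/-- The digits `a₁, …, aₙ₋₁, aₙ - 1, 1` of the other expansion of a rational `0 < a < 1`. -/
def digits' (a : ℚ) : List ℕ :=
  (digits a).dropLast ++ [(digits a).getLastD 0 - 1, 1]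

/-- The quadratic interval `I_a` of a rational `0 < a ≤ 1`: the open interval with endpoints the
values of the two purely periodic continued fractions whose periods are the two expansions of `a`;
for `a = 1` it is `(g, 1)` with `g` the small golden mean. -/
noncomputable def quadInterval (a : ℚ) : Set ℝ :=
  if a = 1 then Set.Ioo ((√5 - 1) / 2) 1
  else Set.Ioo (min (cfPeriodic [] (digits a)) (cfPeriodic [] (digits' a)))
    (max (cfPeriodic [] (digits a)) (cfPeriodic [] (digits' a)))

/-- The set `ℛ` of rationals `0 < a ≤ 1` whose quadratic interval is maximal, that is, not properly
contained in another quadratic interval. -/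
def maximalRationals : Set ℚ :=
  {a | 0 < a ∧ a ≤ 1 ∧ ∀ b : ℚ, 0 < b → b ≤ 1 → ¬ quadInterval a ⊂ quadInterval b}

/-- The left interval `J_a^L`, empty for `a = 1`. -/
noncomputable def JL (a : ℚ) : Set ℝ :=
  if a = 1 then ∅
  else if Odd (digits a).length then
    Set.Ioo (cfPeriodic [1] (digits' a)) (cfEval (1 :: digits' a))
  else Set.Ioo (cfPeriodic [1] (digits a)) (cfEval (1 :: digits a))

/-- The right interval `J_a^R`. For `a = 1` (so `n = 1`, `a₁ = 1`) it is `([1, 1], [1, 1, 1, …])`,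
that is, `(1/2, g)`. -/
noncomputable def JR (a : ℚ) : Set ℝ :=
  if Odd (digits a).length then
    Set.Ioo (cfEval (1 :: digits a)) (cfPeriodic [1] (digits a))
  else Set.Ioo (cfEval (1 :: digits' a)) (cfPeriodic [1] (digits' a))

/-- `a₁ + a₃ + a₅ + ⋯`, the sum of the digits with odd (one-based) index. -/
def oddSum (w : List ℕ) : ℕ := ∑ i ∈ Finset.range w.length, if Even i then w.getD i 0 else 0

/-- `a₂ + a₄ + a₆ + ⋯`, the sum of the digits with even (one-based) index. -/
def evenSum (w : List ℕ) : ℕ := ∑ i ∈ Finset.range w.length, if Odd i then w.getD i 0 else 0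

/-- `M = a₁ + a₃ + ⋯ + aₙ` for odd `n` and `M = a₁ + a₃ + ⋯ + aₙ₋₁ + 1` for even `n`. -/
def M (a : ℚ) : ℕ :=
  if Odd (digits a).length then oddSum (digits a) else oddSum (digits a) + 1

/-- `N = a₂ + a₄ + ⋯ + aₙ₋₁ + 2` for odd `n` and `N = a₂ + a₄ + ⋯ + aₙ + 1` for even `n`. -/
def N (a : ℚ) : ℕ :=
  if Odd (digits a).length then evenSum (digits a) + 2 else evenSum (digits a) + 1

/-! Checks of the definitions. -/

theorem gauss_mem {α x : ℝ} (hα : 0 < α) (hx : 0 < x) (hx1 : x ≤ 1) :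
    x ∈ flipRegion α ↔ gauss x ≤ α := by
  have h1 : 1 ≤ 1 / x := by rw [le_div_iff₀ hx]; linarith
  simp only [flipRegion, Set.mem_iUnion, Set.mem_Icc, gauss, exists_prop]
  constructor
  · rintro ⟨n, hn, h2, h3⟩
    have hn' : (0 : ℝ) < n := by exact_mod_cast hn
    have h4 : (n : ℝ) ≤ 1 / x := by
      rw [le_div_iff₀ hn'] at h3
      rw [le_div_iff₀ hx]; linarith
    have h5 : 1 / x ≤ n + α := by
      rw [div_le_iff₀ (by positivity)] at h2
      rw [div_le_iff₀ hx]; linarith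
    have h6 : ((n : ℤ) : ℝ) ≤ (⌊1 / x⌋ : ℝ) := by
      exact_mod_cast Int.le_floor.2 (by exact_mod_cast h4)
    push_cast at h6
    linarith
  · intro h
    have h0 : 1 ≤ ⌊1 / x⌋ := Int.le_floor.2 (by exact_mod_cast h1)
    obtain ⟨n, hn⟩ := Int.eq_ofNat_of_zero_le (by omega : 0 ≤ ⌊1 / x⌋)
    have hn1 : 1 ≤ n := by omega
    have hn' : (0 : ℝ) < n := by exact_mod_cast hn1
    have h2 : (n : ℝ) ≤ 1 / x := by
      have := Int.floor_le (1 / x)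
      rw [hn] at this
      exact_mod_cast this
    rw [hn] at h
    push_cast at h
    refine ⟨n, hn1, ?_, ?_⟩
    · rw [div_le_iff₀ (by positivity)]
      have : 1 / x ≤ n + α := by linarith
      rw [div_le_iff₀ hx] at this; linarith
    · rw [le_div_iff₀ hn']
      rw [le_div_iff₀ hx] at h2; linarith

/-- `T_α` maps its domain to itself. -/
theorem mapsTo_T {α : ℝ} (h0 : 0 < α) (h1 : α < 1) :
    Set.MapsTo (T α) (Set.Icc (min α (1 - α)) 1) (Set.Icc (min α (1 - α)) 1) := by
  rintro x ⟨hx, hx1⟩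
  have hx0 : 0 < x := lt_of_lt_of_le (lt_min h0 (by linarith)) hx
  have hg0 : 0 ≤ gauss x := Int.fract_nonneg (1 / x)
  have hg1 : gauss x < 1 := Int.fract_lt_one (1 / x)
  unfold T
  split_ifs with h
  · rw [gauss_mem h0 hx0 hx1] at h
    exact ⟨(min_le_right _ _).trans (by linarith), by linarith⟩
  · rw [gauss_mem h0 hx0 hx1, not_le] at h
    exact ⟨(min_le_left _ _).trans h.le, hg1.le⟩

theorem foldr_contract (l : List ℕ) (hl : ∀ d ∈ l, 1 ≤ d) (s t : ℝ)
    (hs : s ∈ Set.Icc (0 : ℝ) 1) (ht : t ∈ Set.Icc (0 : ℝ) 1) :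
    l.foldr (fun (d : ℕ) (x : ℝ) => 1 / ((d : ℝ) + x)) s ∈ Set.Icc (0 : ℝ) 1 ∧
    l.foldr (fun (d : ℕ) (x : ℝ) => 1 / ((d : ℝ) + x)) t ∈ Set.Icc (0 : ℝ) 1 ∧
    |l.foldr (fun (d : ℕ) (x : ℝ) => 1 / ((d : ℝ) + x)) s - l.foldr (fun (d : ℕ) (x : ℝ) => 1 / ((d : ℝ) + x)) t|
      ≤ 2 * (1 / 2) ^ l.length * |s - t| := by
  have key : ∀ (d : ℕ), 1 ≤ d → ∀ x ∈ Set.Icc (0 : ℝ) 1,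
      1 / ((d : ℝ) + x) ∈ Set.Icc (0 : ℝ) 1 := by
    intro d hd x hx
    have : (1 : ℝ) ≤ d := by exact_mod_cast hd
    have := hx.1
    exact ⟨by positivity, by rw [div_le_one (by linarith)]; linarith⟩
  match l with
  | [] =>
    refine ⟨by simpa using hs, by simpa using ht, ?_⟩
    have := abs_nonneg (s - t)
    simp only [List.foldr_nil, List.length_nil, pow_zero]
    linarith
  | [d] =>
    have hd := hl d (by simp)
    have hd' : (1 : ℝ) ≤ d := by exact_mod_cast hd
    refine ⟨key d hd s hs, key d hd t ht, ?_⟩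
    have h1 : (1 : ℝ) ≤ d + s := by linarith [hs.1]
    have h2 : (1 : ℝ) ≤ d + t := by linarith [ht.1]
    have e : 1 / ((d : ℝ) + s) - 1 / (d + t) = (t - s) / ((d + s) * (d + t)) := by
      field_simp; ring
    simp only [List.foldr_cons, List.foldr_nil, List.length_cons, List.length_nil]
    rw [e, abs_div, abs_sub_comm t s, abs_of_pos (by positivity : 0 < ((d : ℝ) + s) * (d + t)),
      div_le_iff₀ (by positivity)]
    have h3 : (1 : ℝ) ≤ (d + s) * (d + t) := by nlinarith
    nlinarith [abs_nonneg (s - t)]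
  | d :: e :: l =>
    obtain ⟨hX, hY, hc⟩ := foldr_contract l (fun x hx => hl x (by simp [hx])) s t hs ht
    simp only [List.foldr_cons, List.length_cons]
    generalize l.foldr (fun (d : ℕ) (x : ℝ) => 1 / ((d : ℝ) + x)) s = X at *
    generalize l.foldr (fun (d : ℕ) (x : ℝ) => 1 / ((d : ℝ) + x)) t = Y at *
    have hd := hl d (by simp)
    have he := hl e (by simp)
    refine ⟨key d hd _ (key e he X hX), key d hd _ (key e he Y hY), ?_⟩
    have hd' : (1 : ℝ) ≤ d := by exact_mod_cast hd
    have he' : (1 : ℝ) ≤ e := by exact_mod_cast he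
    have h1 : (1 : ℝ) ≤ e + X := by linarith [hX.1]
    have h2 : (1 : ℝ) ≤ e + Y := by linarith [hY.1]
    have h3 : (2 : ℝ) ≤ d * (e + X) + 1 := by nlinarith
    have h4 : (2 : ℝ) ≤ d * (e + Y) + 1 := by nlinarith
    have e1 : 1 / ((d : ℝ) + 1 / (e + X)) - 1 / ((d : ℝ) + 1 / (e + Y))
        = (X - Y) / ((d * (e + X) + 1) * (d * (e + Y) + 1)) := by
      have : (d : ℝ) + 1 / (e + X) ≠ 0 := by positivity
      have : (d : ℝ) + 1 / (e + Y) ≠ 0 := by positivity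
      field_simp; ring
    have hp : (0 : ℝ) < (d * (e + X) + 1) * (d * (e + Y) + 1) := by
      apply mul_pos <;> linarith
    rw [e1, abs_div, abs_of_pos hp, div_le_iff₀ hp]
    have h5 : (4 : ℝ) ≤ (d * (e + X) + 1) * (d * (e + Y) + 1) := by nlinarith
    have h6 : (0 : ℝ) ≤ 2 * (1 / 2) ^ (l.length + 1 + 1) * |s - t| := by positivity
    have h7 : 2 * (1 / 2 : ℝ) ^ l.length * |s - t|
        = 2 * (1 / 2) ^ (l.length + 1 + 1) * |s - t| * 4 := by ring
    rw [h7] at hc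
    exact hc.trans (mul_le_mul_of_nonneg_left h5 h6)

/-- The limit that defines an infinite continued fraction with positive digits exists. -/
theorem tendsto_cfLimit (d : ℕ → ℕ) (hd : ∀ i, 1 ≤ d i) :
    Tendsto (fun n : ℕ => cfEval ((List.range n).map d)) atTop (𝓝 (cfLimit d)) := by
  apply CauchySeq.tendsto_limUnder
  refine cauchySeq_of_le_geometric (1 / 2) 2 (by norm_num) fun n => ?_
  have hm : ∀ x ∈ (List.range n).map d, 1 ≤ x := by
    intro x hx
    obtain ⟨i, -, rfl⟩ := List.mem_map.1 hx
    exact hd i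
  have h1 : (1 : ℝ) ≤ d n := by exact_mod_cast hd n
  have ht : 1 / ((d n : ℝ) + 0) ∈ Set.Icc (0 : ℝ) 1 := by
    rw [add_zero]
    exact ⟨by positivity, by rw [div_le_one (by linarith)]; exact h1⟩
  have h := (foldr_contract _ hm 0 _ (by simp) ht).2.2
  rw [List.range_succ, List.map_append, Real.dist_eq]
  simp only [cfEval, List.foldr_append, List.map_cons, List.map_nil, List.foldr_cons,
    List.foldr_nil]
  refine h.trans ?_
  rw [List.length_map, List.length_range, zero_sub, abs_neg, abs_of_nonneg ht.1]
  exact mul_le_of_le_one_right (by positivity) ht.2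

theorem cfEval_euclidDigits (p q : ℕ) (hq : 0 < q) : cfEval (euclidDigits p q) = p / q := by
  induction p using Nat.strong_induction_on generalizing q with
  | _ p ih =>
    match p with
    | 0 => simp [euclidDigits, cfEval]
    | p + 1 =>
      have h := ih (q % (p + 1)) (Nat.mod_lt _ (Nat.succ_pos _)) (p + 1) (Nat.succ_pos _)
      rw [euclidDigits]
      unfold cfEval at h ⊢
      rw [List.foldr_cons, h]
      have hc : ((p + 1 : ℕ) : ℝ) * ((q / (p + 1) : ℕ) : ℝ) + ((q % (p + 1) : ℕ) : ℝ) = q := by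
        exact_mod_cast Nat.div_add_mod q (p + 1)
      have hp : (0 : ℝ) < ((p + 1 : ℕ) : ℝ) := by positivity
      have hq' : (0 : ℝ) < q := by exact_mod_cast hq
      have : ((q / (p + 1) : ℕ) : ℝ) + ((q % (p + 1) : ℕ) : ℝ) / ((p + 1 : ℕ) : ℝ)
          = q / ((p + 1 : ℕ) : ℝ) := by
        rw [← hc]; field_simp
      rw [this, one_div_div]

/-- The digits of `a` are a continued fraction expansion of `a`. -/
theorem cfEval_digits (a : ℚ) (ha : 0 < a) : cfEval (digits a) = a := by
  rw [digits, cfEval_euclidDigits _ _ a.den_pos]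
  have h : ((a.num.toNat : ℕ) : ℤ) = a.num := Int.toNat_of_nonneg (Rat.num_nonneg.2 ha.le)
  have h' : ((a.num.toNat : ℕ) : ℝ) = (a.num : ℝ) := by exact_mod_cast h
  rw [h', Rat.cast_def]

end FlippedCF

/-!
Every `α` in a matching interval is `1 / (1 + x)` with `x ∈ I_a`, `x ≠ a`, and such an `x` is
`[w₁, …, wₘ + s]` where `w` is one of the two expansions of `a` and `0 < s < x`: the two words give
the two halves of `I_a` on the two sides of `a`. (For `a = 1` there is only `w = [1]`.) The word of even length gives `J_a^L`, the one of
odd length `J_a^R`, and for both words the claim becomes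
`T_α^(w₁ + w₃ + ⋯ + 1) α = T_α^(w₂ + w₄ + ⋯ + 1) (1 - α)`.

Write `t_k = [w_{k+1}, …, wₘ + s]` and `[d, y] = 1 / (d + y)` for a real tail `y`. If `d ≥ 2`, a
flip takes `1 / (c + [d, y])` to `1 - [d, y] = 1 / (1 + [d - 1, y])`; if `d = 1`, it produces
`1 - [1, y] = [e + 1, …]`, where `e` is the first digit of `y`. Hence `α`
spends `w₁` steps on the digit `w₁`, swallows `w₂`, spends `w₃` steps on `w₃`, and so on, while
`1 - α = [w₁ + 1, w₂, …]` spends its time on `w₂, w₄, …`. All this holds as long as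
`1 / (1 + t_k) ≤ α`, that is, `x ≤ t_k`, for `0 < k < m`. Since `s < x`, the orbit that counts `wₘ`
fails to flip at its end, and after one more step both orbits are at `1 - s`
(`iterate_T_word`, `iterate_T_matching`).

That `x ≤ t_k` follows from maximality (`not_hasLowTail`). Otherwise take the smallest `k` for which
some point of the half interval has `t_k < x`, and let `u` be the first `k` digits. By continuity
and minimality all points of the half interval have a low tail at `k` (`HasLowTail.forall_lt`), the
strict inequality persists at `a` because `a` is rational and periodic points are not, and it then
carries over to the other half (`HasLowTail.transfer`). So all of `I_a` lies in the half interval of `u`,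
which has a rational endpoint, unlike `I_a`, and is part of the quadratic interval of `[u]`.
Hence `I_a` is not maximal.
-/

namespace FlippedCF

open Filter Topology

/-! ### Finite continued fractions with a real tail -/

/-- The value `[w₁, …, wₘ₋₁, wₘ + s]` of a finite continued fraction with real tail `s`: the
inverse branch, belonging to the word `w`, of an iterate of the Gauss map, evaluated at `s`. -/
noncomputable def cfMap (w : List ℕ) (s : ℝ) : ℝ :=
  w.foldr (fun (d : ℕ) (x : ℝ) => 1 / ((d : ℝ) + x)) s

theorem cfMap_nil (s : ℝ) : cfMap [] s = s := rfl

theorem cfMap_cons (d : ℕ) (w : List ℕ) (s : ℝ) : cfMap (d :: w) s = 1 / (d + cfMap w s) := rfl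

theorem cfMap_append (u v : List ℕ) (s : ℝ) : cfMap (u ++ v) s = cfMap u (cfMap v s) := by
  simp [cfMap]

theorem cfEval_eq_cfMap (w : List ℕ) : cfEval w = cfMap w 0 := rfl

theorem cfMap_nonneg (w : List ℕ) {s : ℝ} (hs : 0 ≤ s) : 0 ≤ cfMap w s := by
  induction w with
  | nil => exact hs
  | cons d w ih => rw [cfMap_cons]; positivity

theorem cfMap_pos {w : List ℕ} (hw : ∀ d ∈ w, 1 ≤ d) (hne : w ≠ []) {s : ℝ} (hs : 0 ≤ s) :
    0 < cfMap w s := by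
  obtain ⟨d, v, rfl⟩ := List.exists_cons_of_ne_nil hne
  have hd : (1 : ℝ) ≤ d := by exact_mod_cast hw d (by simp)
  have := cfMap_nonneg v hs
  rw [cfMap_cons]; positivity

theorem cfMap_mem_Ioo {w : List ℕ} (hw : ∀ d ∈ w, 1 ≤ d) {s : ℝ} (hs : s ∈ Set.Ioo (0 : ℝ) 1) :
    cfMap w s ∈ Set.Ioo (0 : ℝ) 1 := by
  induction w with
  | nil => exact hs
  | cons d w ih =>
    have hd : (1 : ℝ) ≤ d := by exact_mod_cast hw d (by simp)
    have := (ih fun x hx => hw x (by simp [hx])).1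
    rw [cfMap_cons]
    exact ⟨by positivity, by rw [div_lt_one (by positivity)]; linarith⟩

theorem continuousOn_cfMap {w : List ℕ} (hw : ∀ d ∈ w, 1 ≤ d) :
    ContinuousOn (cfMap w) (Set.Ici 0) := by
  induction w with
  | nil => exact continuousOn_id
  | cons d w ih =>
    have hd : (1 : ℝ) ≤ d := by exact_mod_cast hw d (by simp)
    refine ContinuousOn.div continuousOn_const
      (continuousOn_const.add (ih fun x hx => hw x (by simp [hx]))) fun s hs => ?_
    have := cfMap_nonneg w (Set.mem_Ici.1 hs)
    change (d : ℝ) + cfMap w s ≠ 0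
    positivity

/-- Each digit reverses the order, so monotonicity is governed by the parity of the length. -/
theorem cfMap_parity {w : List ℕ} (hw : ∀ d ∈ w, 1 ≤ d) :
    (Even w.length → StrictMonoOn (cfMap w) (Set.Ici 0)) ∧
      (Odd w.length → StrictAntiOn (cfMap w) (Set.Ici 0)) := by
  induction w with
  | nil => exact ⟨fun _ => strictMonoOn_id, fun h => by simp at h⟩
  | cons d w ih =>
    obtain ⟨h1, h2⟩ := ih fun x hx => hw x (by simp [hx])
    have hd : (1 : ℝ) ≤ d := by exact_mod_cast hw d (by simp)
    have key : ∀ s ∈ Set.Ici (0 : ℝ), 0 < (d : ℝ) + cfMap w s := fun s hs => by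
      have := cfMap_nonneg w (Set.mem_Ici.1 hs)
      positivity
    constructor
    · intro h s hs t ht hst
      have h' : Odd w.length := by simpa [Nat.even_add_one] using h
      exact one_div_lt_one_div_of_lt (key t ht) (add_lt_add_right (h2 h' hs ht hst) _)
    · intro h s hs t ht hst
      have h' : Even w.length := by simpa [Nat.odd_add_one] using h
      exact one_div_lt_one_div_of_lt (key s hs) (add_lt_add_right (h1 h' hs ht hst) _)

theorem injOn_cfMap {w : List ℕ} (hw : ∀ d ∈ w, 1 ≤ d) : Set.InjOn (cfMap w) (Set.Ici 0) := by
  rcases Nat.even_or_odd w.length with h | h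
  · exact ((cfMap_parity hw).1 h).injOn
  · exact ((cfMap_parity hw).2 h).injOn

/-! ### Purely periodic continued fractions as fixed points -/

theorem cfLimit_nonneg {d : ℕ → ℕ} (hd : ∀ i, 1 ≤ d i) : 0 ≤ cfLimit d :=
  ge_of_tendsto' (tendsto_cfLimit d hd) fun n => by
    rw [cfEval_eq_cfMap]; exact cfMap_nonneg _ le_rfl

theorem cfLimit_eq_cfMap {d d' : ℕ → ℕ} (hd : ∀ i, 1 ≤ d i) {u : List ℕ}
    (hu : (List.range u.length).map d = u) (hd' : ∀ i, d' i = d (u.length + i)) :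
    cfLimit d = cfMap u (cfLimit d') := by
  have hd1 : ∀ i, 1 ≤ d' i := fun i => hd' i ▸ hd _
  have hu1 : ∀ x ∈ u, 1 ≤ x := fun x hx => by
    rw [← hu] at hx
    obtain ⟨i, -, rfl⟩ := List.mem_map.1 hx
    exact hd i
  have h1 := (tendsto_cfLimit d hd).comp (tendsto_add_atTop_nat u.length)
  have h2 : Tendsto (fun n => cfMap u (cfEval ((List.range n).map d'))) atTop
      (𝓝 (cfMap u (cfLimit d'))) := by
    refine ((continuousOn_cfMap hu1) _ (cfLimit_nonneg hd1)).tendsto.comp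
      (tendsto_nhdsWithin_iff.2 ⟨tendsto_cfLimit d' hd1, Eventually.of_forall fun n => ?_⟩)
    rw [cfEval_eq_cfMap]; exact cfMap_nonneg _ le_rfl
  refine tendsto_nhds_unique h1 (h2.congr fun n => ?_)
  rw [Function.comp_apply, cfEval_eq_cfMap, ← cfMap_append, add_comm n, List.range_add,
    List.map_append, hu, List.map_map, cfEval_eq_cfMap]
  congr 3
  funext i
  exact hd' i

theorem evPeriodic_nil_pos {w : List ℕ} (hw : ∀ d ∈ w, 1 ≤ d) (hne : w ≠ []) (i : ℕ) :
    1 ≤ evPeriodic [] w i := by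
  have h : i % w.length < w.length := Nat.mod_lt _ (List.length_pos_iff.2 hne)
  simp only [evPeriodic, List.length_nil, Nat.not_lt_zero, if_false, Nat.sub_zero]
  rw [List.getD_eq_getElem _ _ h]
  exact hw _ (List.getElem_mem h)

/-- A purely periodic continued fraction is fixed by the map of its period. -/
theorem cfMap_cfPeriodic {w : List ℕ} (hw : ∀ d ∈ w, 1 ≤ d) (hne : w ≠ []) :
    cfMap w (cfPeriodic [] w) = cfPeriodic [] w := by
  refine (cfLimit_eq_cfMap (evPeriodic_nil_pos hw hne) ?_ fun i => ?_).symm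
  · refine List.ext_getElem (by simp) fun i h1 h2 => ?_
    simp only [List.getElem_map, List.getElem_range, evPeriodic, List.length_nil,
      Nat.not_lt_zero, if_false, Nat.sub_zero]
    rw [Nat.mod_eq_of_lt h2, List.getD_eq_getElem _ _ h2]
  · simp [evPeriodic]

theorem cfPeriodic_one {w : List ℕ} (hw : ∀ d ∈ w, 1 ≤ d) (hne : w ≠ []) :
    cfPeriodic [1] w = 1 / (1 + cfPeriodic [] w) := by
  have h : cfPeriodic [1] w = cfMap [1] (cfPeriodic [] w) := by
    refine cfLimit_eq_cfMap (fun i => ?_) (by simp [evPeriodic]) fun i => ?_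
    · rcases i with _ | i
      · simp [evPeriodic]
      · simpa [evPeriodic] using evPeriodic_nil_pos hw hne i
    · simp [evPeriodic]
  rw [h, cfMap_cons, cfMap_nil, Nat.cast_one]

theorem cfPeriodic_mem_Ioo {w : List ℕ} (hw : ∀ d ∈ w, 1 ≤ d) (hne : w ≠ []) :
    cfPeriodic [] w ∈ Set.Ioo (0 : ℝ) 1 := by
  have h0 : 0 ≤ cfPeriodic [] w := cfLimit_nonneg (evPeriodic_nil_pos hw hne)
  have hp : 0 < cfPeriodic [] w := by
    rw [← cfMap_cfPeriodic hw hne]; exact cfMap_pos hw hne h0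
  refine ⟨hp, ?_⟩
  have hf := cfMap_cfPeriodic hw hne
  obtain ⟨d, v, rfl⟩ := List.exists_cons_of_ne_nil hne
  have hd : (1 : ℝ) ≤ d := by exact_mod_cast hw d (by simp)
  rw [← hf, cfMap_cons]
  have hv : 0 < cfMap v (cfPeriodic [] (d :: v)) := by
    rcases eq_or_ne v [] with rfl | hv
    · exact hp
    · exact cfMap_pos (fun x hx => hw x (by simp [hx])) hv h0
  rw [div_lt_one (by positivity)]
  linarith

/-- The sign of `cfMap w s - s` tells the side of the fixed point on which `s` lies: for odd length
because the map is decreasing, for even length because it is a contraction. -/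
theorem lt_cfMap_iff {w : List ℕ} (hw : ∀ d ∈ w, 1 ≤ d) (hne : w ≠ []) {s : ℝ}
    (hs : s ∈ Set.Icc (0 : ℝ) 1) : s < cfMap w s ↔ s < cfPeriodic [] w := by
  have hP := cfPeriodic_mem_Ioo hw hne
  have hf := cfMap_cfPeriodic hw hne
  set P := cfPeriodic [] w
  rcases Nat.even_or_odd w.length with h | h
  · have hl : 2 ≤ w.length := by
      have := List.length_pos_iff.2 hne
      rcases h with ⟨r, hr⟩
      omega
    have hc := (foldr_contract w hw s P hs ⟨hP.1.le, hP.2.le⟩).2.2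
    change |cfMap w s - cfMap w P| ≤ _ at hc
    rw [hf] at hc
    have h2 : (1 / 2 : ℝ) ^ w.length ≤ (1 / 2) ^ 2 :=
      pow_le_pow_of_le_one (by norm_num) (by norm_num) hl
    have h3 : |cfMap w s - P| ≤ 1 / 2 * |s - P| :=
      hc.trans (mul_le_mul_of_nonneg_right (by linarith) (abs_nonneg _))
    constructor
    · intro h4
      by_contra! h5
      rw [abs_of_nonneg (sub_nonneg.2 h5)] at h3
      linarith [le_abs_self (cfMap w s - P)]
    · intro h4
      rw [abs_of_neg (sub_neg.2 h4)] at h3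
      linarith [neg_abs_le (cfMap w s - P)]
  · have ha := (cfMap_parity hw).2 h
    constructor
    · intro h4
      by_contra! h5
      have := ha.antitoneOn (Set.mem_Ici.2 hP.1.le) (Set.mem_Ici.2 hs.1) h5
      linarith
    · intro h4
      have := ha (Set.mem_Ici.2 hs.1) (Set.mem_Ici.2 hP.1.le) h4
      linarith

theorem image_cfMap_even {w : List ℕ} (hw : ∀ d ∈ w, 1 ≤ d) (hne : w ≠ []) (h : Even w.length) :
    cfMap w '' Set.Ioo 0 (cfPeriodic [] w) = Set.Ioo (cfMap w 0) (cfPeriodic [] w) := by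
  have hP := cfPeriodic_mem_Ioo hw hne
  have hf := cfMap_cfPeriodic hw hne
  have hm := (cfMap_parity hw).1 h
  apply Set.Subset.antisymm
  · rintro _ ⟨s, hs, rfl⟩
    have := hm (Set.mem_Ici.2 hs.1.le) (Set.mem_Ici.2 hP.1.le) hs.2
    exact ⟨hm (Set.mem_Ici.2 le_rfl) (Set.mem_Ici.2 hs.1.le) hs.1, by rwa [hf] at this⟩
  · have := intermediate_value_Ioo hP.1.le
      ((continuousOn_cfMap hw).mono fun x hx => Set.mem_Ici.2 hx.1)
    rwa [hf] at this

theorem image_cfMap_odd {w : List ℕ} (hw : ∀ d ∈ w, 1 ≤ d) (hne : w ≠ []) (h : Odd w.length) :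
    cfMap w '' Set.Ioo 0 (cfPeriodic [] w) = Set.Ioo (cfPeriodic [] w) (cfMap w 0) := by
  have hP := cfPeriodic_mem_Ioo hw hne
  have hf := cfMap_cfPeriodic hw hne
  have hm := (cfMap_parity hw).2 h
  apply Set.Subset.antisymm
  · rintro _ ⟨s, hs, rfl⟩
    have := hm (Set.mem_Ici.2 hs.1.le) (Set.mem_Ici.2 hP.1.le) hs.2
    exact ⟨by rwa [hf] at this, hm (Set.mem_Ici.2 le_rfl) (Set.mem_Ici.2 hs.1.le) hs.1⟩
  · have := intermediate_value_Ioo' hP.1.le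
      ((continuousOn_cfMap hw).mono fun x hx => Set.mem_Ici.2 hx.1)
    rwa [hf] at this

/-- Inverting a branch does not increase denominators, and decreases them for nonempty words. -/
theorem den_descent {w : List ℕ} (hw : ∀ d ∈ w, 1 ≤ d) {s : ℝ} (hs : s ∈ Set.Ioo (0 : ℝ) 1)
    {p q : ℤ} (hq : 0 < q) (h : cfMap w s = p / q) :
    ∃ p' q' : ℤ, 0 < q' ∧ s = p' / q' ∧ q' ≤ q ∧ (w ≠ [] → q' < q) := by
  induction w generalizing p q with
  | nil => exact ⟨p, q, hq, h, le_rfl, fun h => absurd rfl h⟩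
  | cons d w ih =>
    have hw' : ∀ x ∈ w, 1 ≤ x := fun x hx => hw x (by simp [hx])
    have h0 := cfMap_mem_Ioo hw hs
    have h1 := cfMap_mem_Ioo hw' hs
    have hq' : (0 : ℝ) < q := by exact_mod_cast hq
    rw [h] at h0
    have hp : (0 : ℝ) < p := by
      have := mul_pos h0.1 hq'
      rwa [div_mul_cancel₀ _ hq'.ne'] at this
    have hpq : (p : ℝ) < q := by
      have := h0.2
      rwa [div_lt_one hq'] at this
    have hd : (1 : ℝ) ≤ d := by exact_mod_cast hw d (by simp)
    have h2 : cfMap w s = ((q - d * p : ℤ) : ℝ) / (p : ℤ) := by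
      rw [cfMap_cons] at h
      have h3 : (0 : ℝ) < d + cfMap w s := by linarith [h1.1]
      rw [div_eq_div_iff h3.ne' hq'.ne'] at h
      rw [eq_div_iff hp.ne']
      push_cast
      linarith
    obtain ⟨p', q', a, b, c, -⟩ := ih hw' (by exact_mod_cast hp) h2
    have : p < q := by exact_mod_cast hpq
    exact ⟨p', q', a, b, by omega, fun _ => by omega⟩

theorem irrational_cfPeriodic {w : List ℕ} (hw : ∀ d ∈ w, 1 ≤ d) (hne : w ≠ []) :
    Irrational (cfPeriodic [] w) := by
  have key : ∀ n : ℕ, ∀ p q : ℤ, 0 < q → q ≤ n → cfPeriodic [] w ≠ p / q := by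
    intro n
    induction n with
    | zero => intro p q h1 h2; push_cast at h2; omega
    | succ n ih =>
      intro p q h1 h2 h
      obtain ⟨p', q', a, b, -, c⟩ := den_descent hw (cfPeriodic_mem_Ioo hw hne) h1
        ((cfMap_cfPeriodic hw hne).trans h)
      exact ih p' q' a (by have := c hne; push_cast at h2; omega) b
  rintro ⟨r, hr⟩
  refine key r.den r.num r.den (by exact_mod_cast r.den_pos) le_rfl ?_
  rw [← hr, Rat.cast_def]
  simp

theorem exists_rat_eq_cfMap_zero (w : List ℕ) : ∃ r : ℚ, (r : ℝ) = cfMap w 0 := by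
  induction w with
  | nil => exact ⟨0, by simp [cfMap]⟩
  | cons d w ih =>
    obtain ⟨r, hr⟩ := ih
    exact ⟨1 / (d + r), by rw [cfMap_cons, ← hr]; push_cast; rfl⟩

/-! ### Orbits of the flipped map along continued fraction digits -/

theorem gauss_one_div {c : ℕ} (y : ℝ) (hy0 : 0 ≤ y) (hy1 : y < 1) :
    gauss (1 / (c + y)) = y := by
  have h : ⌊(c : ℝ) + y⌋ = (c : ℤ) := by
    rw [Int.floor_eq_iff]; push_cast; constructor <;> linarith
  rw [gauss, one_div_one_div, h]
  push_cast
  ring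

theorem T_one_div {α : ℝ} (hα : 0 < α) {c : ℕ} (hc : 1 ≤ c) {y : ℝ} (hy0 : 0 ≤ y) (hy1 : y < 1) :
    T α (1 / (c + y)) = if y ≤ α then 1 - y else y := by
  have hc' : (1 : ℝ) ≤ c := by exact_mod_cast hc
  have h := gauss_mem (x := 1 / (c + y)) hα (by positivity)
    (by rw [div_le_one (by positivity)]; linarith)
  rw [gauss_one_div y hy0 hy1] at h
  simp only [T, h, gauss_one_div y hy0 hy1]

/-- A digit `d` is used up by `d` steps: the first `d - 1` are flips since their Gauss images are
at most `1 / 2`, and only the last one depends on the position of the tail. -/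
theorem iterate_T_digit {α : ℝ} (hα : 1 / 2 ≤ α) {c d : ℕ} (hc : 1 ≤ c) {y : ℝ} (hy : 0 < y) :
    (T α)^[d + 1] (1 / (c + 1 / ((d + 1 : ℕ) + y))) =
      if 1 / (1 + y) ≤ α then y / (1 + y) else 1 / (1 + y) := by
  induction d generalizing c with
  | zero =>
    have h1 : 1 / (1 + y) < 1 := by rw [div_lt_one (by positivity)]; linarith
    have h2 : 1 - 1 / (1 + y) = y / (1 + y) := by field_simp; ring
    rw [Function.iterate_one, Nat.zero_add, Nat.cast_one,
      T_one_div (by linarith) hc (by positivity) h1, h2]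
  | succ d ih =>
    have h1 : 1 / (((d + 1 + 1 : ℕ) : ℝ) + y) ≤ 1 / 2 := by
      apply one_div_le_one_div_of_le (by norm_num)
      push_cast
      linarith [Nat.cast_nonneg (α := ℝ) d]
    have h2 : 1 - 1 / (((d + 1 + 1 : ℕ) : ℝ) + y) = 1 / ((1 : ℕ) + 1 / ((d + 1 : ℕ) + y)) := by
      push_cast; field_simp; ring
    rw [Function.iterate_succ_apply, T_one_div (by linarith) hc (by positivity) (by linarith),
      if_pos (h1.trans hα), h2, ih le_rfl]

theorem oddSum_cons (d : ℕ) (w : List ℕ) : oddSum (d :: w) = d + evenSum w := by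
  simp only [oddSum, evenSum, List.length_cons, Finset.sum_range_succ', List.getD_cons_succ,
    Nat.even_add_one, Nat.not_even_iff_odd]
  simp [add_comm]

theorem evenSum_cons (d : ℕ) (w : List ℕ) : evenSum (d :: w) = oddSum w := by
  simp only [oddSum, evenSum, List.length_cons, Finset.sum_range_succ', List.getD_cons_succ,
    Nat.odd_add_one, Nat.not_odd_iff_even]
  simp

/-- Every second digit is counted in steps, the others are swallowed by flips. The orbit follows
the digits `w` down to the tail `s` and arrives at `1 - s`, whatever the parity of the length:
if the last digit is counted, the last but one step is not a flip, and this takes up the slack. -/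
theorem iterate_T_word {x s : ℝ} (hx : x ≤ 1) (hs : 0 < s) (hsx : s < x) (hsα : s ≤ 1 / (1 + x)) :
    ∀ (w : List ℕ) (c : ℕ), (∀ d ∈ w, 1 ≤ d) → 1 ≤ c →
      (∀ l, l <:+ w → l ≠ [] → l ≠ w → x ≤ cfMap l s) →
      (T (1 / (1 + x)))^[oddSum w + 1] (1 / (c + cfMap w s)) = 1 - s := by
  have hx0 : 0 < x := hs.trans hsx
  have hα : 1 / 2 ≤ 1 / (1 + x) := one_div_le_one_div_of_le (by linarith) (by linarith)
  have hα0 : 0 < 1 / (1 + x) := by positivity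
  have last : ∀ c : ℕ, 1 ≤ c → T (1 / (1 + x)) (1 / (c + s)) = 1 - s := fun c hc => by
    rw [T_one_div hα0 hc hs.le (by linarith), if_pos hsα]
  intro w
  induction w using List.twoStepInduction with
  | nil => intro c _ hc _; exact last c hc
  | singleton d =>
    intro c hw hc _
    obtain ⟨d, rfl⟩ := Nat.exists_eq_add_of_le' (hw d (by simp))
    have h1 : ¬ 1 / (1 + s) ≤ 1 / (1 + x) := by
      rw [not_le]; exact one_div_lt_one_div_of_lt (by linarith) (by linarith)
    have h2 : oddSum [d + 1] = d + 1 := by rw [oddSum_cons]; simp [evenSum]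
    rw [h2, Function.iterate_succ_apply', cfMap_cons, cfMap_nil, iterate_T_digit hα hc hs,
      if_neg h1]
    simpa using last 1 le_rfl
  | cons_cons d e w ih _ =>
    intro c hw hc hl
    obtain ⟨d, rfl⟩ := Nat.exists_eq_add_of_le' (hw d (by simp))
    have ht := hl (e :: w) (List.suffix_cons _ _) (by simp) (by simp)
    have he : (1 : ℝ) ≤ e := by exact_mod_cast hw e (by simp)
    have hw0 := cfMap_nonneg w hs.le
    have ht' : 1 / (1 + cfMap (e :: w) s) ≤ 1 / (1 + x) :=
      one_div_le_one_div_of_le (by linarith) (by linarith)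
    have h2 : cfMap (e :: w) s / (1 + cfMap (e :: w) s) = 1 / ((e + 1 : ℕ) + cfMap w s) := by
      rw [cfMap_cons]; push_cast; field_simp; ring
    have h3 : oddSum ((d + 1) :: e :: w) + 1 = (oddSum w + 1) + (d + 1) := by
      rw [oddSum_cons, evenSum_cons]; ring
    rw [h3, Function.iterate_add_apply, cfMap_cons, iterate_T_digit hα hc (by linarith),
      if_pos ht', h2]
    refine ih (e + 1) (fun x hx => hw x (by simp [hx])) (by omega) fun l h4 h5 h6 => hl l ?_ h5 ?_
    · exact (h4.trans (List.suffix_cons _ _)).trans (List.suffix_cons _ _)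
    · rintro rfl
      have := h4.length_le
      simp at this

/-- Matching for a word `w` all of whose proper tails stay above `x = [w₁, …, wₘ + s]`, while `s`
itself is below `x`: both orbits arrive at `1 - s`. -/
theorem iterate_T_matching {w : List ℕ} (hw : ∀ d ∈ w, 1 ≤ d) (hne : w ≠ []) {s : ℝ}
    (hs : 0 < s) (hs1 : s < 1) (hsx : s < cfMap w s)
    (hl : ∀ l, l <:+ w → l ≠ [] → l ≠ w → cfMap w s ≤ cfMap l s) :
    (T (1 / (1 + cfMap w s)))^[oddSum w + 1] (1 / (1 + cfMap w s)) =
      (T (1 / (1 + cfMap w s)))^[evenSum w + 1] (1 - 1 / (1 + cfMap w s)) := by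
  have hx1 := (cfMap_mem_Ioo hw ⟨hs, hs1⟩).2.le
  have hx0 := (cfMap_mem_Ioo hw ⟨hs, hs1⟩).1
  obtain ⟨d, v, rfl⟩ := List.exists_cons_of_ne_nil hne
  have hv : ∀ x ∈ v, 1 ≤ x := fun x hx => hw x (by simp [hx])
  have hd : (1 : ℝ) ≤ d := by exact_mod_cast hw d (by simp)
  have hv0 := (cfMap_mem_Ioo hv ⟨hs, hs1⟩).1
  have e1 : cfMap (d :: v) s * (d + cfMap v s) = 1 := by
    rw [cfMap_cons]; field_simp
  -- the tail is in the flip region: `s` is below the tail of `x` after one digit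
  have hsα : s ≤ 1 / (1 + cfMap (d :: v) s) := by
    rw [le_div_iff₀ (by linarith)]
    have : s ≤ cfMap v s := by
      rcases eq_or_ne v [] with rfl | hv'
      · exact le_rfl
      · exact hsx.le.trans (hl v (List.suffix_cons _ _) hv' (by simp))
    nlinarith
  have h1 := iterate_T_word hx1 hs hsx hsα (d :: v) 1 hw le_rfl hl
  have h2 := iterate_T_word hx1 hs hsx hsα v (d + 1) hv (by omega) fun l h4 h5 h6 =>
    hl l (h4.trans (List.suffix_cons _ _)) h5 (by
      rintro rfl
      have := h4.length_le
      simp at this)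
  have h3 : 1 - 1 / (1 + cfMap (d :: v) s) = 1 / ((d + 1 : ℕ) + cfMap v s) := by
    rw [cfMap_cons]; push_cast; field_simp; ring
  rw [evenSum_cons, h3, h2]
  simpa using h1

/-! ### Digits of a rational and of the word it comes from -/

theorem euclidDigits_spec (x y : ℕ) (hx : 0 < x) (hxy : x < y) :
    ∃ (p : List ℕ) (m : ℕ), (∀ d ∈ p, 1 ≤ d) ∧ 2 ≤ m ∧ euclidDigits x y = p ++ [m] := by
  induction x using Nat.strong_induction_on generalizing y with
  | _ x ih =>
    obtain ⟨x, rfl⟩ := Nat.exists_eq_succ_of_ne_zero hx.ne'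
    rw [Nat.succ_eq_add_one] at *
    rw [euclidDigits]
    rcases Nat.eq_zero_or_pos (y % (x + 1)) with h | h
    · refine ⟨[], y / (x + 1), by simp, ?_, by rw [h, euclidDigits]; rfl⟩
      obtain ⟨c, rfl⟩ := Nat.dvd_of_mod_eq_zero h
      rw [Nat.mul_div_cancel_left _ hx]
      by_contra! hc
      interval_cases c <;> omega
    · obtain ⟨p, m, hp, hm, he⟩ := ih _ (Nat.mod_lt y hx) (x + 1) h (Nat.mod_lt y hx)
      refine ⟨y / (x + 1) :: p, m, ?_, hm, by rw [he]; rfl⟩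
      intro d hd
      rcases List.mem_cons.1 hd with rfl | hd
      · exact Nat.div_pos hxy.le hx
      · exact hp d hd

theorem exists_euclidDigits_eq (p : List ℕ) (hp : ∀ d ∈ p, 1 ≤ d) (m : ℕ) (hm : 2 ≤ m) :
    ∃ x y : ℕ, 0 < x ∧ x < y ∧ Nat.Coprime x y ∧ euclidDigits x y = p ++ [m] := by
  induction p with
  | nil =>
    refine ⟨1, m, one_pos, hm, Nat.coprime_one_left m, ?_⟩
    rw [euclidDigits, Nat.zero_add, Nat.mod_one, Nat.div_one, euclidDigits]
    rfl
  | cons d p ih =>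
    obtain ⟨x, y, hx, hxy, hc, he⟩ := ih fun e h => hp e (by simp [h])
    have hd := hp d (by simp)
    have hy : 0 < y := by omega
    refine ⟨y, x + y * d, hy, ?_, ?_, ?_⟩
    · have := Nat.mul_le_mul_left y hd
      omega
    · rw [Nat.coprime_add_mul_left_right]
      exact hc.symm
    · obtain ⟨y, rfl⟩ := Nat.exists_eq_succ_of_ne_zero hy.ne'
      rw [Nat.succ_eq_add_one] at *
      rw [euclidDigits, Nat.add_mul_mod_self_left, Nat.mod_eq_of_lt hxy, he,
        Nat.add_mul_div_left _ _ hy, Nat.div_eq_of_lt hxy, Nat.zero_add]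
      rfl

theorem digits_spec {a : ℚ} (h0 : 0 < a) (h1 : a < 1) :
    ∃ (p : List ℕ) (m : ℕ), (∀ d ∈ p, 1 ≤ d) ∧ 2 ≤ m ∧ digits a = p ++ [m] := by
  have h2 : 0 < a.num := Rat.num_pos.2 h0
  have h3 : a.num < a.den := by
    have := Rat.lt_iff a 1 |>.1 h1
    simpa using this
  exact euclidDigits_spec _ _ (by omega) (by omega)

theorem digits'_eq {a : ℚ} {p : List ℕ} {m : ℕ} (h : digits a = p ++ [m]) :
    digits' a = p ++ [m - 1, 1] := by
  simp [digits', h]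

theorem digits_one : digits 1 = [1] := by
  have : euclidDigits 1 1 = [1] := by
    rw [euclidDigits, Nat.zero_add, Nat.mod_one, Nat.div_one, euclidDigits]
  simpa [digits] using this

theorem exists_digits_eq {p : List ℕ} (hp : ∀ d ∈ p, 1 ≤ d) {m : ℕ} (hm : 2 ≤ m) :
    ∃ b : ℚ, 0 < b ∧ b < 1 ∧ digits b = p ++ [m] := by
  obtain ⟨x, y, hx, hxy, hc, he⟩ := exists_euclidDigits_eq p hp m hm
  have hy : (0 : ℚ) < y := by exact_mod_cast hx.trans hxy
  have hx' : (0 : ℚ) < x := by exact_mod_cast hx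
  refine ⟨x / y, by positivity, by rw [div_lt_one hy]; exact_mod_cast hxy, ?_⟩
  have hn := Rat.num_div_eq_of_coprime (a := x) (b := y) (by exact_mod_cast hx.trans hxy)
    (by simpa using hc)
  have hd := Rat.den_div_eq_of_coprime (a := x) (b := y) (by exact_mod_cast hx.trans hxy)
    (by simpa using hc)
  push_cast at hn hd
  rw [digits, hn, ← he]
  congr 1
  exact_mod_cast hd

theorem cfMap_split_last {m : ℕ} (hm : 1 ≤ m) (p : List ℕ) :
    cfMap (p ++ [m - 1, 1]) 0 = cfMap (p ++ [m]) 0 := by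
  rw [cfMap_append, cfMap_append]
  congr 1
  simp only [cfMap_cons, cfMap_nil]
  rw [Nat.cast_sub hm]
  norm_num

theorem pos_append_singleton {p : List ℕ} (hp : ∀ d ∈ p, 1 ≤ d) {m : ℕ} (hm : 2 ≤ m) :
    ∀ d ∈ p ++ [m], 1 ≤ d := by
  intro d hd
  rcases List.mem_append.1 hd with h | h
  · exact hp d h
  · simp at h; omega

theorem pos_append_pair {p : List ℕ} (hp : ∀ d ∈ p, 1 ≤ d) {m : ℕ} (hm : 2 ≤ m) :
    ∀ d ∈ p ++ [m - 1, 1], 1 ≤ d := by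
  intro d hd
  rcases List.mem_append.1 hd with h | h
  · exact hp d h
  · simp at h; omega

/-! ### The two halves of a quadratic interval -/

/-- The points `[w₁, …, wₘ + s]` whose tail `s` lies below the periodic point of the word `w`,
equivalently below the point itself: the open interval between `[w₁, …, wₘ]` and the periodic
point of `w`. It is one half of the quadratic interval of the rational `[w₁, …, wₘ]`. -/
noncomputable def halfInterval (w : List ℕ) : Set ℝ := cfMap w '' Set.Ioo 0 (cfPeriodic [] w)

theorem cfMap_zero_lt {w : List ℕ} (hw : ∀ d ∈ w, 1 ≤ d) (hne : w ≠ []) (h : Even w.length) :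
    cfMap w 0 < cfPeriodic [] w := by
  have hP := cfPeriodic_mem_Ioo hw hne
  conv_rhs => rw [← cfMap_cfPeriodic hw hne]
  exact (cfMap_parity hw).1 h (Set.mem_Ici.2 le_rfl) (Set.mem_Ici.2 hP.1.le) hP.1

theorem lt_cfMap_zero {w : List ℕ} (hw : ∀ d ∈ w, 1 ≤ d) (hne : w ≠ []) (h : Odd w.length) :
    cfPeriodic [] w < cfMap w 0 := by
  have hP := cfPeriodic_mem_Ioo hw hne
  conv_lhs => rw [← cfMap_cfPeriodic hw hne]
  exact (cfMap_parity hw).2 h (Set.mem_Ici.2 le_rfl) (Set.mem_Ici.2 hP.1.le) hP.1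

theorem min_max_split {e o : List ℕ} (he : ∀ d ∈ e, 1 ≤ d) (ho : ∀ d ∈ o, 1 ≤ d) (hne : e ≠ [])
    (hno : o ≠ []) (hee : Even e.length) (hoo : Odd o.length) (h : cfMap e 0 = cfMap o 0) :
    Set.Ioo (min (cfPeriodic [] o) (cfPeriodic [] e)) (max (cfPeriodic [] o) (cfPeriodic [] e)) =
      halfInterval e ∪ halfInterval o ∪ {cfMap e 0} := by
  have h1 := cfMap_zero_lt he hne hee
  have h2 := lt_cfMap_zero ho hno hoo
  rw [← h] at h2
  rw [halfInterval, halfInterval, image_cfMap_even he hne hee, image_cfMap_odd ho hno hoo, ← h,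
    min_eq_left (h2.trans h1).le, max_eq_right (h2.trans h1).le]
  ext x
  simp only [Set.mem_Ioo, Set.mem_union, Set.mem_singleton_iff]
  constructor
  · rintro ⟨h3, h4⟩
    rcases lt_trichotomy x (cfMap e 0) with h5 | h5 | h5
    · exact Or.inl (Or.inr ⟨h3, h5⟩)
    · exact Or.inr h5
    · exact Or.inl (Or.inl ⟨h5, h4⟩)
  · rintro ((⟨h3, h4⟩ | ⟨h3, h4⟩) | rfl) <;> constructor <;> linarith

theorem quadInterval_eq {a : ℚ} (h0 : 0 < a) (h1 : a < 1) :
    quadInterval a = halfInterval (digits a) ∪ halfInterval (digits' a) ∪ {(a : ℝ)} := by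
  obtain ⟨p, m, hp, hm, h⟩ := digits_spec h0 h1
  have h' := digits'_eq h
  have hc : cfMap (digits' a) 0 = cfMap (digits a) 0 := by
    rw [h, h', cfMap_split_last (by omega)]
  have ha : cfMap (digits a) 0 = a := cfEval_digits a h0
  have hw : ∀ d ∈ digits a, 1 ≤ d := h ▸ pos_append_singleton hp hm
  have hw' : ∀ d ∈ digits' a, 1 ≤ d := h' ▸ pos_append_pair hp hm
  have hn : digits a ≠ [] := by simp [h]
  have hn' : digits' a ≠ [] := by simp [h']
  have hl : (digits' a).length = (digits a).length + 1 := by simp [h, h']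
  rw [quadInterval, if_neg h1.ne]
  rcases Nat.even_or_odd (digits a).length with hl1 | hl1
  · rw [min_comm, max_comm, min_max_split hw hw' hn hn' hl1 (hl ▸ hl1.add_one) hc.symm, ha]
  · rw [min_max_split hw' hw hn' hn (hl ▸ hl1.add_one) hl1 hc, hc, ha,
      Set.union_comm (halfInterval _)]

/-- The periodic point of `w = [1]` is the golden mean, so `I₁` is a half interval. -/
theorem cfPeriodic_singleton_one : cfPeriodic [] [1] = (√5 - 1) / 2 := by
  have h1 := cfPeriodic_mem_Ioo (w := [1]) (by simp) (by simp)
  have h2 := cfMap_cfPeriodic (w := [1]) (by simp) (by simp)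
  rw [cfMap_cons, cfMap_nil, Nat.cast_one] at h2
  have h3 : (0 : ℝ) < 1 + cfPeriodic [] [1] := by linarith [h1.1]
  rw [div_eq_iff h3.ne'] at h2
  have h4 : √5 = 2 * cfPeriodic [] [1] + 1 := by
    rw [Real.sqrt_eq_iff_mul_self_eq (by norm_num) (by linarith [h1.1])]
    linarith
  rw [h4]; ring

theorem halfInterval_one : halfInterval [1] = quadInterval 1 := by
  rw [halfInterval, image_cfMap_odd (by simp) (by simp) (by simp), quadInterval, if_pos rfl,
    cfPeriodic_singleton_one]
  simp [cfMap]

/-- Every half interval is contained in some quadratic interval. -/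
theorem exists_halfInterval_subset {u : List ℕ} (hu : ∀ d ∈ u, 1 ≤ d) (hne : u ≠ []) :
    ∃ b : ℚ, 0 < b ∧ b ≤ 1 ∧ halfInterval u ⊆ quadInterval b := by
  obtain ⟨q, l, rfl⟩ : ∃ q l, u = q ++ [l] := ⟨_, _, (List.dropLast_append_getLast hne).symm⟩
  have hq : ∀ d ∈ q, 1 ≤ d := fun d hd => hu d (by simp [hd])
  have hl := hu l (by simp)
  rcases hl.eq_or_lt with rfl | hl
  · rcases eq_or_ne q [] with rfl | hqn
    · exact ⟨1, one_pos, le_rfl, by rw [List.nil_append, halfInterval_one]⟩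
    · obtain ⟨p, m, rfl⟩ : ∃ p m, q = p ++ [m] := ⟨_, _, (List.dropLast_append_getLast hqn).symm⟩
      have hm := hq m (by simp)
      obtain ⟨b, h0, h1, h2⟩ := exists_digits_eq (fun d hd => hq d (by simp [hd]))
        (show 2 ≤ m + 1 by omega) (p := p)
      refine ⟨b, h0, h1.le, ?_⟩
      rw [quadInterval_eq h0 h1, digits'_eq h2]
      intro x hx
      refine Or.inl (Or.inr ?_)
      simpa using hx
  · obtain ⟨b, h0, h1, h2⟩ := exists_digits_eq hq hl
    refine ⟨b, h0, h1.le, ?_⟩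
    rw [quadInterval_eq h0 h1, h2]
    exact fun x hx => Or.inl (Or.inl hx)

/-- A half interval has one rational and one irrational endpoint. -/
theorem halfInterval_ne_Ioo {u : List ℕ} (hu : ∀ d ∈ u, 1 ≤ d) (hne : u ≠ []) {l r : ℝ}
    (hl : Irrational l) (hr : Irrational r) (hlr : l < r) : halfInterval u ≠ Set.Ioo l r := by
  intro h
  obtain ⟨c, hc⟩ := exists_rat_eq_cfMap_zero u
  rw [halfInterval] at h
  rcases Nat.even_or_odd u.length with hp | hp
  · rw [image_cfMap_even hu hne hp] at h
    have := congrArg sInf h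
    rw [csInf_Ioo (cfMap_zero_lt hu hne hp), csInf_Ioo hlr] at this
    exact hl ⟨c, hc.trans this⟩
  · rw [image_cfMap_odd hu hne hp] at h
    have := congrArg sSup h
    rw [csSup_Ioo (lt_cfMap_zero hu hne hp), csSup_Ioo hlr] at this
    exact hr ⟨c, hc.trans this⟩

/-! ### Tails of the points of a quadratic interval -/

theorem prefix_or_prefix_of_cfMap_eq {u v : List ℕ} (hu : ∀ d ∈ u, 1 ≤ d) (hv : ∀ d ∈ v, 1 ≤ d)
    {r s : ℝ} (hr : r ∈ Set.Ioo (0 : ℝ) 1) (hs : s ∈ Set.Ioo (0 : ℝ) 1)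
    (h : cfMap v s = cfMap u r) : v <+: u ∨ u <+: v := by
  induction v generalizing u with
  | nil => exact Or.inl List.nil_prefix
  | cons d v ih =>
    cases u with
    | nil => exact Or.inr List.nil_prefix
    | cons e u =>
      have hu' : ∀ d ∈ u, 1 ≤ d := fun x hx => hu x (by simp [hx])
      have hv' : ∀ d ∈ v, 1 ≤ d := fun x hx => hv x (by simp [hx])
      have h1 := cfMap_mem_Ioo hu' hr
      have h2 := cfMap_mem_Ioo hv' hs
      rw [cfMap_cons, cfMap_cons, one_div, one_div, inv_inj] at h
      have h3 : (d : ℝ) < e + 1 := by linarith [h1.2, h2.1]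
      have h4 : (e : ℝ) < d + 1 := by linarith [h1.1, h2.2]
      have h5 : d < e + 1 := by exact_mod_cast h3
      have h6 : e < d + 1 := by exact_mod_cast h4
      obtain rfl : d = e := by omega
      simpa using ih hu' hv' (add_left_cancel h)

/-- The digits of the periodic point of `u` being those of `u u u ⋯`, each of its tails is also
reached by a proper prefix of `u`. -/
theorem exists_prefix_cfMap_eq {u v : List ℕ} (hu : ∀ d ∈ u, 1 ≤ d) (hne : u ≠ [])
    (hv : ∀ d ∈ v, 1 ≤ d) {s : ℝ} (hs : s ∈ Set.Ioo (0 : ℝ) 1)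
    (h : cfMap v s = cfPeriodic [] u) :
    ∃ u', u' <+: u ∧ u' ≠ u ∧ cfMap u' s = cfPeriodic [] u := by
  have hP := cfPeriodic_mem_Ioo hu hne
  have hf := cfMap_cfPeriodic hu hne
  induction hn : v.length using Nat.strong_induction_on generalizing v with
  | _ n ih =>
    by_cases hp : u <+: v
    · obtain ⟨v', rfl⟩ := hp
      have hv' : ∀ d ∈ v', 1 ≤ d := fun x hx => hv x (by simp [hx])
      have := List.length_pos_iff.2 hne
      rw [cfMap_append, ← hf] at h
      refine ih v'.length (by rw [← hn, List.length_append]; omega) hv' ?_ rfl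
      exact injOn_cfMap hu (Set.mem_Ici.2 (cfMap_nonneg _ hs.1.le)) (Set.mem_Ici.2 hP.1.le)
        (h.trans (by rw [hf]))
    · refine ⟨v, ?_, ?_, h⟩
      · exact (prefix_or_prefix_of_cfMap_eq hu hv hP hs (h.trans hf.symm)).resolve_right hp
      · rintro rfl
        exact hp (List.prefix_refl _)

/-- The word `w` has a low tail at position `k`: some point `x` of its half interval is larger than
its own tail after `k` digits. The last inequality expresses this, by `lt_cfMap_iff`, through the
periodic point of the first `k` digits. -/
def HasLowTail (w : List ℕ) (k : ℕ) : Prop :=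
  0 < k ∧ k < w.length ∧ ∃ s ∈ Set.Ioo 0 (cfPeriodic [] w),
    cfMap (w.drop k) s < cfPeriodic [] (w.take k)

/-- At the first position where some point of the half interval has a low tail, all points do:
otherwise, by continuity, some point is the periodic point of the first `k` digits, and then the
tail at an earlier position is low. -/
theorem HasLowTail.forall_lt {w : List ℕ} (hw : ∀ d ∈ w, 1 ≤ d) {k : ℕ} (hk : HasLowTail w k)
    (hmin : ∀ j < k, ¬ HasLowTail w j) {s : ℝ} (hs : s ∈ Set.Ico 0 (cfPeriodic [] w)) :
    cfMap (w.drop k) s < cfPeriodic [] (w.take k) := by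
  obtain ⟨hk0, hk1, s₁, hs₁, hlt⟩ := hk
  have hwne : w ≠ [] := by rintro rfl; simp at hk1
  have hune : w.take k ≠ [] := by simp [hk0.ne', hwne]
  have hu : ∀ d ∈ w.take k, 1 ≤ d := fun d hd => hw d (List.mem_of_mem_take hd)
  have hv : ∀ d ∈ w.drop k, 1 ≤ d := fun d hd => hw d (List.mem_of_mem_drop hd)
  have hPw := cfPeriodic_mem_Ioo hw hwne
  have hPu := cfPeriodic_mem_Ioo hu hune
  by_contra! hge
  obtain ⟨t, ht, hte⟩ := isPreconnected_Ico.intermediate_value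
    (⟨hs₁.1.le, hs₁.2⟩ : s₁ ∈ Set.Ico 0 (cfPeriodic [] w)) hs
    ((continuousOn_cfMap hv).mono fun x hx => Set.mem_Ici.2 hx.1) ⟨hlt.le, hge⟩
  have ht0 : 0 < t := by
    refine ht.1.lt_of_ne ?_
    rintro rfl
    obtain ⟨c, hc⟩ := exists_rat_eq_cfMap_zero (w.drop k)
    exact irrational_cfPeriodic hu hune ⟨c, hc.trans hte⟩
  have ht1 : t < 1 := ht.2.trans hPw.2
  have hwt : cfMap w t = cfPeriodic [] (w.take k) := by
    conv_lhs => rw [← List.take_append_drop k w]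
    rw [cfMap_append, hte, cfMap_cfPeriodic hu hune]
  have htw : t < cfPeriodic [] (w.take k) := by
    rw [← hwt]
    exact (lt_cfMap_iff hw hwne ⟨ht0.le, ht1.le⟩).2 ht.2
  obtain ⟨u', hp, hne', he⟩ := exists_prefix_cfMap_eq hu hune hv ⟨ht0, ht1⟩ hte
  have hu'ne : u' ≠ [] := by
    rintro rfl
    exact htw.ne he
  have hu' : ∀ d ∈ u', 1 ≤ d := fun d hd => hu d (hp.subset hd)
  have hlen : u'.length < k := by
    refine lt_of_le_of_ne (hp.length_le.trans (List.length_take_le _ _)) fun h => hne' ?_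
    refine hp.eq_of_length ?_
    rw [h, List.length_take, min_eq_left hk1.le]
  obtain ⟨v', rfl⟩ : u' <+: w := hp.trans (List.take_prefix _ _)
  refine hmin u'.length hlen ⟨List.length_pos_iff.2 hu'ne, hlen.trans hk1, t, ⟨ht0, ht.2⟩, ?_⟩
  rw [List.drop_left, List.take_left]
  have h1 : cfMap v' t = t := by
    refine injOn_cfMap hu' (Set.mem_Ici.2 (cfMap_nonneg _ ht0.le)) (Set.mem_Ici.2 ht0.le) ?_
    rw [← cfMap_append, hwt, he]
  rw [h1, ← lt_cfMap_iff hu' hu'ne ⟨ht0.le, ht1.le⟩, he]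
  exact htw

/-- The first low tail of `w` is low at the rational endpoint of the half interval, so it is shared
with any other word `w'` of the same value that agrees with `w` up to there. -/
theorem HasLowTail.transfer {w w' : List ℕ} (hw : ∀ d ∈ w, 1 ≤ d) (hw' : ∀ d ∈ w', 1 ≤ d)
    (h0 : cfMap w 0 = cfMap w' 0) {k : ℕ} (hk : HasLowTail w k)
    (hmin : ∀ j < k, ¬ HasLowTail w j) (htake : w.take k = w'.take k) (hk' : k < w'.length) :
    HasLowTail w' k := by
  have hne : w ≠ [] := by rintro rfl; have := hk.2.1; simp at this
  have hne' : w' ≠ [] := by rintro rfl; simp at hk'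
  have hu : ∀ d ∈ w.take k, 1 ≤ d := fun d hd => hw d (List.mem_of_mem_take hd)
  have hv' : ∀ d ∈ w'.drop k, 1 ≤ d := fun d hd => hw' d (List.mem_of_mem_drop hd)
  have hlt := hk.forall_lt hw hmin ⟨le_rfl, (cfPeriodic_mem_Ioo hw hne).1⟩
  have heq : cfMap (w'.drop k) 0 = cfMap (w.drop k) 0 := by
    refine injOn_cfMap hu (Set.mem_Ici.2 (cfMap_nonneg _ le_rfl))
      (Set.mem_Ici.2 (cfMap_nonneg _ le_rfl)) ?_
    rw [← cfMap_append (w.take k) (w.drop k), List.take_append_drop, htake, ← cfMap_append,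
      List.take_append_drop, h0]
  rw [← heq, htake] at hlt
  have hc : Tendsto (cfMap (w'.drop k)) (𝓝[>] 0) (𝓝 (cfMap (w'.drop k) 0)) :=
    ((continuousOn_cfMap hv') 0 (Set.mem_Ici.2 le_rfl)).mono Set.Ioi_subset_Ici_self
  obtain ⟨s, h1, h2⟩ := ((hc.eventually_lt_const hlt).and
    (Ioo_mem_nhdsGT (cfPeriodic_mem_Ioo hw' hne').1)).exists
  exact ⟨hk.1, hk', s, h2, h1⟩

theorem exists_common_first_lowTail {w w' : List ℕ} (hw : ∀ d ∈ w, 1 ≤ d) (hw' : ∀ d ∈ w', 1 ≤ d)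
    (h0 : cfMap w 0 = cfMap w' 0) {K : ℕ} (htake : w.take K = w'.take K) (hK : K < w.length)
    (hK' : K < w'.length) {k : ℕ} (hkK : k ≤ K) (hk : HasLowTail w k) :
    ∃ j ≤ K, HasLowTail w j ∧ HasLowTail w' j ∧ (∀ i < j, ¬ HasLowTail w i) ∧
      ∀ i < j, ¬ HasLowTail w' i := by
  classical
  have htk : ∀ j ≤ K, w.take j = w'.take j := fun j hj => by
    have := congrArg (List.take j) htake
    rwa [List.take_take, List.take_take, min_eq_left hj] at this
  have hex : ∃ j, HasLowTail w j := ⟨k, hk⟩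
  have hjK : Nat.find hex ≤ K := (Nat.find_min' hex hk).trans hkK
  have hj := Nat.find_spec hex
  have hmin : ∀ i < Nat.find hex, ¬ HasLowTail w i := fun i hi => Nat.find_min hex hi
  have hj' := hj.transfer hw hw' h0 hmin (htk _ hjK) (by omega)
  refine ⟨_, hjK, hj, hj', hmin, fun i hi hi' => ?_⟩
  have hex' : ∃ j, HasLowTail w' j := ⟨i, hi'⟩
  have hle := Nat.find_min' hex' hi'
  exact hmin (Nat.find hex') (by omega) ((Nat.find_spec hex').transfer hw' hw h0.symm
    (fun i hi => Nat.find_min hex' hi) (htk _ (by omega)).symm (by omega))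

theorem HasLowTail.halfInterval_subset {w : List ℕ} (hw : ∀ d ∈ w, 1 ≤ d) {k : ℕ}
    (hk : HasLowTail w k) (hmin : ∀ j < k, ¬ HasLowTail w j) :
    halfInterval w ⊆ halfInterval (w.take k) ∧ cfMap w 0 ∈ halfInterval (w.take k) := by
  have hv : ∀ d ∈ w.drop k, 1 ≤ d := fun d hd => hw d (List.mem_of_mem_drop hd)
  have hvne : w.drop k ≠ [] := by simpa using hk.2.1
  have hne : w ≠ [] := by rintro rfl; have := hk.2.1; simp at this
  have key : ∀ s ∈ Set.Ico 0 (cfPeriodic [] w), cfMap w s ∈ halfInterval (w.take k) := by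
    intro s hs
    refine ⟨cfMap (w.drop k) s, ⟨cfMap_pos hv hvne hs.1, hk.forall_lt hw hmin hs⟩, ?_⟩
    rw [← cfMap_append, List.take_append_drop]
  refine ⟨?_, key 0 ⟨le_rfl, (cfPeriodic_mem_Ioo hw hne).1⟩⟩
  rintro _ ⟨s, hs, rfl⟩
  exact key s ⟨hs.1.le, hs.2⟩

/-- The expansion with last digit `1` has no low tail just before that digit unless it has one after
the first digit: such a tail forces `x` to lie above the golden mean, hence into `I₁`. -/
theorem HasLowTail.one_of_last {p : List ℕ} (hp : ∀ d ∈ p, 1 ≤ d) {m : ℕ} (hm : 2 ≤ m)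
    (h : HasLowTail (p ++ [m - 1, 1]) (p.length + 1)) :
    p ≠ [] ∧ HasLowTail (p ++ [m - 1, 1]) 1 := by
  have hw := pos_append_pair hp hm
  obtain ⟨-, -, s, hs, hlt⟩ := h
  have hwne : p ++ [m - 1, 1] ≠ [] := by simp
  have hs1 : s < 1 := hs.2.trans (cfPeriodic_mem_Ioo hw hwne).2
  have hsx := (lt_cfMap_iff hw hwne ⟨hs.1.le, hs1.le⟩).2 hs.2
  have hx := cfMap_mem_Ioo hw ⟨hs.1, hs1⟩
  have e1 : p ++ [m - 1, 1] = (p ++ [m - 1]) ++ [1] := by simp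
  have hu : ∀ d ∈ p ++ [m - 1], 1 ≤ d := fun d hd => hw d (e1 ▸ List.mem_append_left [1] hd)
  have e2 : (p ++ [m - 1]).length = p.length + 1 := by simp
  rw [e1, ← e2, List.drop_left, List.take_left, cfMap_cons, cfMap_nil, Nat.cast_one] at hlt
  have ht : 1 / (1 + s) < 1 := by rw [div_lt_one (by linarith [hs.1])]; linarith [hs.1]
  have ht0 : 0 < 1 / (1 + s) := by have := hs.1; positivity
  rw [← lt_cfMap_iff hu (by simp) ⟨ht0.le, ht.le⟩] at hlt
  have e3 : cfMap (p ++ [m - 1]) (1 / (1 + s)) = cfMap (p ++ [m - 1, 1]) s := by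
    rw [e1, cfMap_append _ [1], cfMap_cons, cfMap_nil, Nat.cast_one]
  rw [e3, div_lt_iff₀ (by linarith [hs.1])] at hlt
  have hg : 1 < cfMap (p ++ [m - 1, 1]) s * (1 + cfMap (p ++ [m - 1, 1]) s) := by
    nlinarith [hx.1]
  constructor
  · rintro rfl
    have hm' : (1 : ℝ) ≤ (m - 1 : ℕ) := by exact_mod_cast (by omega : 1 ≤ m - 1)
    simp only [List.nil_append, cfMap_cons, cfMap_nil, Nat.cast_one] at hlt hsx
    have h0 := hs.1
    have h3 : 1 / (((m - 1 : ℕ) : ℝ) + 1 / (1 + s)) ≤ 1 / (1 + 1 / (1 + s)) :=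
      one_div_le_one_div_of_le (by positivity) (by linarith)
    have h4 : 1 / (1 + 1 / (1 + s)) = (1 + s) / (2 + s) := by field_simp; ring
    have h5 : s < (1 + s) / (2 + s) := by linarith
    have h6 : 1 < (1 + s) / (2 + s) * (1 + s) := by nlinarith
    rw [lt_div_iff₀ (by linarith)] at h5
    rw [div_mul_eq_mul_div, lt_div_iff₀ (by linarith)] at h6
    nlinarith
  · obtain ⟨d, v, e⟩ := List.exists_cons_of_ne_nil hwne
    rw [e] at hw hs hx hg ⊢
    have hvne : v ≠ [] := by
      rintro rfl
      have := congrArg List.length e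
      simp at this
    have hv : ∀ d ∈ v, 1 ≤ d := fun x hx => hw x (by simp [hx])
    refine ⟨one_pos, by simpa using List.length_pos_iff.2 hvne, s, hs, ?_⟩
    have hd : 1 ≤ d := hw d (by simp)
    have hv1 := cfMap_mem_Ioo hv ⟨hs.1, hs1⟩
    have hd' : (1 : ℝ) ≤ d := by exact_mod_cast hd
    rw [cfMap_cons] at hg hx
    -- above the golden mean the first digit is `1`
    obtain rfl : d = 1 := by
      by_contra hne
      have h2 : (2 : ℝ) ≤ d := by exact_mod_cast (by omega : 2 ≤ d)
      have h3 : 1 / (d + cfMap v s) ≤ 1 / 2 :=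
        one_div_le_one_div_of_le (by norm_num) (by linarith [hv1.1])
      nlinarith [hx.1]
    simp only [List.drop_succ_cons, List.drop_zero, List.take_succ_cons, List.take_zero]
    rw [← lt_cfMap_iff (by simp) (by simp) ⟨hv1.1.le, hv1.2.le⟩, cfMap_cons, cfMap_nil]
    rw [Nat.cast_one] at hg ⊢
    have h7 : 0 < 1 + cfMap v s := by linarith [hv1.1]
    have h8 : 1 / (1 + cfMap v s) * (1 + 1 / (1 + cfMap v s)) =
        (2 + cfMap v s) / (1 + cfMap v s) ^ 2 := by field_simp; ring
    rw [h8, lt_div_iff₀ (by positivity)] at hg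
    rw [lt_div_iff₀ h7]
    nlinarith

/-- If a quadratic interval is maximal, no point of it has a low tail: by the lemmas above a low
tail would put both halves, and the rational between them, into one half of another interval. -/
theorem not_hasLowTail {a : ℚ} (ha : a ∈ maximalRationals) (ha1 : a ≠ 1) (k : ℕ) :
    ¬ HasLowTail (digits a) k ∧ ¬ HasLowTail (digits' a) k := by
  obtain ⟨h0, hle, hmax⟩ := ha
  have h1 : a < 1 := lt_of_le_of_ne hle ha1
  obtain ⟨p, m, hp, hm, h⟩ := digits_spec h0 h1
  have h' := digits'_eq h
  have hw : ∀ d ∈ digits a, 1 ≤ d := h ▸ pos_append_singleton hp hm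
  have hw' : ∀ d ∈ digits' a, 1 ≤ d := h' ▸ pos_append_pair hp hm
  have hc : cfMap (digits a) 0 = cfMap (digits' a) 0 := by
    rw [h, h', cfMap_split_last (by omega)]
  have hca : cfMap (digits a) 0 = a := cfEval_digits a h0
  have htake : (digits a).take p.length = (digits' a).take p.length := by
    rw [h, h', List.take_left, List.take_left]
  have hK : p.length < (digits a).length := by simp [h]
  have hK' : p.length < (digits' a).length := by simp [h']
  have hn : digits a ≠ [] := by simp [h]
  have hn' : digits' a ≠ [] := by simp [h']
  have main : ∀ j ≤ p.length, HasLowTail (digits a) j → HasLowTail (digits' a) j →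
      (∀ i < j, ¬ HasLowTail (digits a) i) → (∀ i < j, ¬ HasLowTail (digits' a) i) → False := by
    intro j hj hj1 hj2 hm1 hm2
    obtain ⟨s1, s2⟩ := hj1.halfInterval_subset hw hm1
    obtain ⟨s3, -⟩ := hj2.halfInterval_subset hw' hm2
    have htj : (digits a).take j = (digits' a).take j := by
      have := congrArg (List.take j) htake
      rwa [List.take_take, List.take_take, min_eq_left hj] at this
    rw [← htj] at s3
    have hu : ∀ d ∈ (digits a).take j, 1 ≤ d := fun d hd => hw d (List.mem_of_mem_take hd)
    have hune : (digits a).take j ≠ [] := by simp [hj1.1.ne', hn]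
    obtain ⟨b, hb0, hb1, hb⟩ := exists_halfInterval_subset hu hune
    have hsub : quadInterval a ⊆ halfInterval ((digits a).take j) := by
      rw [quadInterval_eq h0 h1, ← hca]
      refine Set.union_subset (Set.union_subset s1 s3) (Set.singleton_subset_iff.2 s2)
    have hss : quadInterval b ⊆ quadInterval a := by
      by_contra hcon
      exact hmax b hb0 hb1 ⟨hsub.trans hb, hcon⟩
    have heq := Set.Subset.antisymm (hb.trans hss) hsub
    have hne : (quadInterval a).Nonempty := ⟨a, by rw [quadInterval_eq h0 h1]; exact Or.inr rfl⟩
    rw [quadInterval, if_neg ha1] at heq hne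
    have i1 := irrational_cfPeriodic hw hn
    have i2 := irrational_cfPeriodic hw' hn'
    refine halfInterval_ne_Ioo hu hune ?_ ?_ (Set.nonempty_Ioo.1 hne) heq
    · rcases min_choice (cfPeriodic [] (digits a)) (cfPeriodic [] (digits' a)) with e | e <;>
        rw [e] <;> assumption
    · rcases max_choice (cfPeriodic [] (digits a)) (cfPeriodic [] (digits' a)) with e | e <;>
        rw [e] <;> assumption
  have main1 : ∀ k ≤ p.length, ¬ HasLowTail (digits a) k := fun k hk hL => by
    obtain ⟨j, q1, q2, q3, q4, q5⟩ := exists_common_first_lowTail hw hw' hc htake hK hK' hk hL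
    exact main j q1 q2 q3 q4 q5
  have main2 : ∀ k ≤ p.length, ¬ HasLowTail (digits' a) k := fun k hk hL => by
    obtain ⟨j, q1, q2, q3, q4, q5⟩ :=
      exists_common_first_lowTail hw' hw hc.symm htake.symm hK' hK hk hL
    exact main j q1 q3 q2 q5 q4
  constructor
  · intro hL
    have := hL.2.1
    exact main1 k (by simp [h] at this; omega) hL
  · intro hL
    by_cases hk : k ≤ p.length
    · exact main2 k hk hL
    · have := hL.2.1
      obtain rfl : k = p.length + 1 := by simp [h'] at this; omega
      rw [h'] at hL
      obtain ⟨hpn, hL1⟩ := hL.one_of_last hp hm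
      rw [← h'] at hL1
      exact main2 1 (List.length_pos_iff.2 hpn) hL1

/-! ### The matching intervals -/

theorem oddSum_evenSum_append (p l : List ℕ) :
    (Even p.length → oddSum (p ++ l) = oddSum p + oddSum l ∧
      evenSum (p ++ l) = evenSum p + evenSum l) ∧
    (Odd p.length → oddSum (p ++ l) = oddSum p + evenSum l ∧
      evenSum (p ++ l) = evenSum p + oddSum l) := by
  induction p with
  | nil => simp [oddSum, evenSum]
  | cons d p ih =>
    rw [List.length_cons, Nat.even_add_one, Nat.odd_add_one, Nat.not_even_iff_odd,
      Nat.not_odd_iff_even, List.cons_append]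
    simp only [oddSum_cons, evenSum_cons]
    refine ⟨fun h => ?_, fun h => ?_⟩
    · obtain ⟨h1, h2⟩ := ih.2 h
      constructor <;> omega
    · obtain ⟨h1, h2⟩ := ih.1 h
      constructor <;> omega

theorem image_one_div_one_add {l r : ℝ} (hl : 0 ≤ l) (hr : 0 ≤ r) :
    (fun x : ℝ => 1 / (1 + x)) '' Set.Ioo l r = Set.Ioo (1 / (1 + r)) (1 / (1 + l)) := by
  ext y
  simp only [Set.mem_image, Set.mem_Ioo]
  constructor
  · rintro ⟨x, ⟨h1, h2⟩, rfl⟩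
    exact ⟨one_div_lt_one_div_of_lt (by linarith) (by linarith),
      one_div_lt_one_div_of_lt (by linarith) (by linarith)⟩
  · rintro ⟨h1, h2⟩
    have hy : 0 < y := lt_trans (by positivity) h1
    rw [div_lt_iff₀ (by linarith)] at h1
    rw [lt_div_iff₀ (by linarith)] at h2
    refine ⟨1 / y - 1, ⟨?_, ?_⟩, by field_simp; ring⟩
    · rw [lt_sub_iff_add_lt, lt_div_iff₀ hy]; linarith
    · rw [sub_lt_iff_lt_add, div_lt_iff₀ hy]; linarith

theorem image_halfInterval_even {w : List ℕ} (hw : ∀ d ∈ w, 1 ≤ d) (hne : w ≠ [])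
    (h : Even w.length) : (fun x : ℝ => 1 / (1 + x)) '' halfInterval w =
      Set.Ioo (cfPeriodic [1] w) (cfEval (1 :: w)) := by
  rw [halfInterval, image_cfMap_even hw hne h, cfPeriodic_one hw hne, cfEval_eq_cfMap, cfMap_cons,
    Nat.cast_one, image_one_div_one_add (cfMap_nonneg _ le_rfl) (cfPeriodic_mem_Ioo hw hne).1.le]

theorem image_halfInterval_odd {w : List ℕ} (hw : ∀ d ∈ w, 1 ≤ d) (hne : w ≠ [])
    (h : Odd w.length) : (fun x : ℝ => 1 / (1 + x)) '' halfInterval w =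
      Set.Ioo (cfEval (1 :: w)) (cfPeriodic [1] w) := by
  rw [halfInterval, image_cfMap_odd hw hne h, cfPeriodic_one hw hne, cfEval_eq_cfMap, cfMap_cons,
    Nat.cast_one, image_one_div_one_add (cfPeriodic_mem_Ioo hw hne).1.le (cfMap_nonneg _ le_rfl)]

/-- Both halves of a maximal quadratic interval match in the same form. The two forms of the theorem
come from the digit sums of the two expansions, which differ by `1`. -/
theorem matching_of_not_hasLowTail {w : List ℕ} (hw : ∀ d ∈ w, 1 ≤ d) (hne : w ≠ [])
    (hL : ∀ k, ¬ HasLowTail w k) {α : ℝ}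
    (hα : α ∈ (fun x : ℝ => 1 / (1 + x)) '' halfInterval w) :
    (T α)^[oddSum w + 1] α = (T α)^[evenSum w + 1] (1 - α) := by
  obtain ⟨_, ⟨s, hs, rfl⟩, rfl⟩ := hα
  have hs1 : s < 1 := hs.2.trans (cfPeriodic_mem_Ioo hw hne).2
  refine iterate_T_matching hw hne hs.1 hs1
    ((lt_cfMap_iff hw hne ⟨hs.1.le, hs1.le⟩).2 hs.2) fun l hl hln hlw => ?_
  obtain ⟨u, rfl⟩ := hl
  have hu : ∀ d ∈ u, 1 ≤ d := fun d hd => hw d (by simp [hd])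
  have hl' : ∀ d ∈ l, 1 ≤ d := fun d hd => hw d (by simp [hd])
  have hun : u ≠ [] := by rintro rfl; simp at hlw
  have hl1 := cfMap_mem_Ioo hl' ⟨hs.1, hs1⟩
  by_contra! hlt
  rw [cfMap_append, lt_cfMap_iff hu hun ⟨hl1.1.le, hl1.2.le⟩] at hlt
  exact hL u.length ⟨List.length_pos_iff.2 hun, by simpa using List.length_pos_iff.2 hln, s, hs,
    by rwa [List.drop_left, List.take_left]⟩

end FlippedCF

theorem theorem3p5 (a : ℚ) (ha : a ∈ FlippedCF.maximalRationals) :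
    (∀ α ∈ FlippedCF.JL a,
      (FlippedCF.T α)^[FlippedCF.M a] α = (FlippedCF.T α)^[FlippedCF.N a] (1 - α)) ∧
    (∀ α ∈ FlippedCF.JR a,
      (FlippedCF.T α)^[FlippedCF.M a + 1] α = (FlippedCF.T α)^[FlippedCF.N a - 1] (1 - α)) ∧
    (a ≠ 1 → (fun x : ℝ => 1 / (1 + x)) '' FlippedCF.quadInterval a =
      FlippedCF.JL a ∪ FlippedCF.JR a ∪ {1 / (1 + (a : ℝ))}) ∧
    (a = 1 → (fun x : ℝ => 1 / (1 + x)) '' FlippedCF.quadInterval a = FlippedCF.JR a) := by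
  open FlippedCF in
  by_cases ha1 : a = 1
  · subst ha1
    have hw : ∀ d ∈ [1], 1 ≤ d := by simp
    have hJ : (fun x : ℝ => 1 / (1 + x)) '' quadInterval 1 = JR 1 := by
      rw [← halfInterval_one, image_halfInterval_odd hw (by simp) (by simp), JR, digits_one,
        if_pos (by simp)]
    refine ⟨by simp [JL], fun α hα => ?_, fun h => absurd rfl h, fun _ => hJ⟩
    rw [← hJ, ← halfInterval_one] at hα
    have hL : ∀ k, ¬ HasLowTail [1] k := by
      rintro k ⟨h1, h2, -⟩
      simp at h2
      omega
    have := matching_of_not_hasLowTail hw (by simp) hL hα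
    simpa [M, N, digits_one, oddSum, evenSum] using this
  · have h0 := ha.1
    have h1 : a < 1 := lt_of_le_of_ne ha.2.1 ha1
    obtain ⟨p, m, hp, hm, h⟩ := digits_spec h0 h1
    have h' := digits'_eq h
    have hw : ∀ d ∈ digits a, 1 ≤ d := h ▸ pos_append_singleton hp hm
    have hw' : ∀ d ∈ digits' a, 1 ≤ d := h' ▸ pos_append_pair hp hm
    have hn : digits a ≠ [] := by simp [h]
    have hn' : digits' a ≠ [] := by simp [h']
    have hl : (digits' a).length = (digits a).length + 1 := by simp [h, h']
    have hlp : (digits a).length = p.length + 1 := by simp [h]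
    have match1 := fun α => matching_of_not_hasLowTail (α := α) hw hn
      fun k => (not_hasLowTail ha ha1 k).1
    have match2 := fun α => matching_of_not_hasLowTail (α := α) hw' hn'
      fun k => (not_hasLowTail ha ha1 k).2
    have hs1 : oddSum [m] = m ∧ evenSum [m] = 0 := by simp [oddSum, evenSum]
    have hs2 : oddSum [m - 1, 1] = m - 1 ∧ evenSum [m - 1, 1] = 1 := by
      simp [oddSum_cons, evenSum_cons]; simp [oddSum, evenSum]
    have himg : (fun x : ℝ => 1 / (1 + x)) '' quadInterval a =
        (fun x : ℝ => 1 / (1 + x)) '' halfInterval (digits a) ∪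
        (fun x : ℝ => 1 / (1 + x)) '' halfInterval (digits' a) ∪ {1 / (1 + (a : ℝ))} := by
      rw [quadInterval_eq h0 h1, Set.image_union, Set.image_union, Set.image_singleton]
    rcases Nat.even_or_odd (digits a).length with hpar | hpar
    · have hno : ¬ Odd (digits a).length := Nat.not_odd_iff_even.2 hpar
      have hpo : Odd p.length := by
        rwa [hlp, Nat.even_add_one, Nat.not_even_iff_odd] at hpar
      have hJL : JL a = (fun x : ℝ => 1 / (1 + x)) '' halfInterval (digits a) := by
        rw [image_halfInterval_even hw hn hpar, JL, if_neg ha1, if_neg hno]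
      have hJR : JR a = (fun x : ℝ => 1 / (1 + x)) '' halfInterval (digits' a) := by
        rw [image_halfInterval_odd hw' hn' (hl ▸ hpar.add_one), JR, if_neg hno]
      obtain ⟨o1, o2⟩ := (oddSum_evenSum_append p [m]).2 hpo
      obtain ⟨o3, o4⟩ := (oddSum_evenSum_append p [m - 1, 1]).2 hpo
      rw [← h] at o1 o2
      rw [← h'] at o3 o4
      refine ⟨fun α hα => ?_, fun α hα => ?_, fun _ => by rw [himg, hJL, hJR],
        fun h => absurd h ha1⟩
      · rw [M, N, if_neg hno, if_neg hno]
        exact match1 α (hJL ▸ hα)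
      · have eM : M a + 1 = oddSum (digits' a) + 1 := by rw [M, if_neg hno]; omega
        have eN : N a - 1 = evenSum (digits' a) + 1 := by rw [N, if_neg hno]; omega
        rw [eM, eN]
        exact match2 α (hJR ▸ hα)
    · have hpe : Even p.length := by
        rwa [hlp, Nat.odd_add_one, Nat.not_odd_iff_even] at hpar
      have hJL : JL a = (fun x : ℝ => 1 / (1 + x)) '' halfInterval (digits' a) := by
        rw [image_halfInterval_even hw' hn' (hl ▸ hpar.add_one), JL, if_neg ha1, if_pos hpar]
      have hJR : JR a = (fun x : ℝ => 1 / (1 + x)) '' halfInterval (digits a) := by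
        rw [image_halfInterval_odd hw hn hpar, JR, if_pos hpar]
      obtain ⟨o1, o2⟩ := (oddSum_evenSum_append p [m]).1 hpe
      obtain ⟨o3, o4⟩ := (oddSum_evenSum_append p [m - 1, 1]).1 hpe
      rw [← h] at o1 o2
      rw [← h'] at o3 o4
      refine ⟨fun α hα => ?_, fun α hα => ?_, fun _ => ?_, fun h => absurd h ha1⟩
      · have eM : M a = oddSum (digits' a) + 1 := by rw [M, if_pos hpar]; omega
        have eN : N a = evenSum (digits' a) + 1 := by rw [N, if_pos hpar]; omega
        rw [eM, eN]
        exact match2 α (hJL ▸ hα)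
      · have eM : M a + 1 = oddSum (digits a) + 1 := by rw [M, if_pos hpar]
        have eN : N a - 1 = evenSum (digits a) + 1 := by rw [N, if_pos hpar]; rfl
        rw [eM, eN]
        exact match1 α (hJR ▸ hα)
      · rw [himg, hJL, hJR, Set.union_comm (_ '' halfInterval (digits a))]
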